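/- All subcategories of the category $\mathbf{Top}$ of topological spaces are full, isomorphism-closed, and contain a space with at least two points. A subcategory $\mathbf A$ of $\mathbf{Top}$ is epireflective if every space has an $\mathbf A$-reflection whose reflection arrow is an epimorphism. A class $\mathbf C\subseteq\mathbf A$ is an HAD-class in $\mathbf A$ if it is closed under subspaces, closed under topological sums, and contains every $Y\in\mathbf A$ that is a quotient space of some $X\in\mathbf C$. For a class $\mathbf B\subseteq\mathbf A$, the HAD-hull $\mathrm{HAD}_{\mathbf A}(\mathbf B)$ is the smallest HAD-class in $\mathbf A$ containing $\mathbf B$. $\mathrm{CH}(\mathbf B)$ denotes the smallest coreflective subcategory of $\mathbf{Top}$ containing $\mathbf B$, $\mathrm{SCH}(\mathbf B)$ the smallest coreflective subcategory of $\mathbf{Top}$ that contains $\mathbf B$ and is closed under subspaces, and $\mathrm{S}(\mathbf C)$ the class of all subspaces of spaces from $\mathbf C$. A prime space is a topological space with precisely one accumulation point. Corollary 4.9. Let $\mathbf A$ be an epireflective subcategory of $\mathbf{Top}$ that does not contain the two-point indiscrete space, and let $\mathbf B\subseteq\mathbf A$ contain at least one prime space. Then the three hulls $\mathrm{HAD}_{\mathbf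 A}(\mathbf B)$, $\mathrm{CH}(\mathbf B)$, $\mathrm{SCH}(\mathbf B)$ exist, and $$\mathrm{HAD}_{\mathbf A}(\mathbf B)=\mathrm{SCH}(\mathbf B)\cap\mathbf A=\mathrm S(\mathrm{CH}(\mathbf B))\cap\mathbf A .$$ That is, $\mathrm{HAD}_{\mathbf A}(\mathbf B)$ consists precisely of the members of $\mathbf A$ that are subspaces of quotients of topological sums of spaces from $\mathbf B$. -/

import Mathlib

open CategoryTheory Topology Filter

universe u

/-- A full isomorphism-closed subcategory of the category of topological spaces, given by its class
of objects; it is always required to contain a space with at least two points. -/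
structure IsTopSubcategory (C : ObjectProperty TopCat.{u}) : Prop where
  iso_closed : ∀ ⦃X Y : TopCat.{u}⦄, Nonempty (X ≅ Y) → C X → C Y
  exists_nontrivial : ∃ X : TopCat.{u}, C X ∧ Nontrivial X

/-- `A` is epireflective in the category of topological spaces: every space has an
`A`-reflection, and the reflection arrow is an epimorphism. -/
structure IsEpireflective (A : ObjectProperty TopCat.{u}) : Prop extends IsTopSubcategory A where
  exists_reflection : ∀ X : TopCat.{u}, ∃ (R : TopCat.{u}) (r : X ⟶ R), A R ∧ Epi r ∧
    ∀ (Y : TopCat.{u}), A Y → ∀ f : X ⟶ Y, ∃! g : R ⟶ Y, r ≫ g = f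

/-- `C` is coreflective in the category of topological spaces: every space has a
`C`-coreflection. -/
structure IsCoreflective (C : ObjectProperty TopCat.{u}) : Prop extends IsTopSubcategory C where
  exists_coreflection : ∀ X : TopCat.{u}, ∃ (R : TopCat.{u}) (c : R ⟶ X), C R ∧
    ∀ (Y : TopCat.{u}), C Y → ∀ f : Y ⟶ X, ∃! g : Y ⟶ R, g ≫ c = f

/-- The spaces that are (homeomorphic to) subspaces of spaces from `C`. -/
def subspacesOf (C : ObjectProperty TopCat.{u}) : ObjectProperty TopCat.{u} :=
  fun X => ∃ Y : TopCat.{u}, C Y ∧ ∃ f : X → Y, IsEmbedding f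

/-- The spaces that are quotient spaces of spaces from `C`. -/
def quotientsOf (C : ObjectProperty TopCat.{u}) : ObjectProperty TopCat.{u} :=
  fun Y => ∃ X : TopCat.{u}, C X ∧ ∃ q : X → Y, IsQuotientMap q

/-- The spaces that are (homeomorphic to) topological sums of set-indexed families of spaces
from `C`. -/
def sumsOf (C : ObjectProperty TopCat.{u}) : ObjectProperty TopCat.{u} :=
  fun X => ∃ (ι : Type u) (Y : ι → TopCat.{u}), (∀ i, C (Y i)) ∧ Nonempty (X ≃ₜ (Σ i, Y i))

/-- `C` is hereditary: closed under subspaces. -/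
def IsHereditary (C : ObjectProperty TopCat.{u}) : Prop := subspacesOf C ≤ C

/-- `C` is additive: closed under topological sums. -/
def IsAdditive (C : ObjectProperty TopCat.{u}) : Prop := sumsOf C ≤ C

/-- `C` is divisible in `A`: every space from `A` that is a quotient of a space from `C` belongs
to `C`. -/
def IsDivisibleIn (A C : ObjectProperty TopCat.{u}) : Prop := quotientsOf C ⊓ A ≤ C

/-- `C` is an HAD-class in `A`: a subcategory of `A` that is hereditary, additive and divisible
in `A`. -/
structure IsHADClass (A C : ObjectProperty TopCat.{u}) : Prop extends IsTopSubcategory C where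
  le : C ≤ A
  hereditary : IsHereditary C
  additive : IsAdditive C
  divisible : IsDivisibleIn A C

/-- `C` is a hereditary coreflective subcategory of the category of topological spaces. -/
def IsHereditaryCoreflective (C : ObjectProperty TopCat.{u}) : Prop :=
  IsCoreflective C ∧ IsHereditary C

/-- The intersection of all classes that contain `B` and have the property `P`. It is the smallest
such class if there is one. -/
def hull (P : ObjectProperty TopCat.{u} → Prop) (B : ObjectProperty TopCat.{u}) :
    ObjectProperty TopCat.{u} :=
  fun X => ∀ C : ObjectProperty TopCat.{u}, P C → B ≤ C → C X

/-- The HAD-hull of `B` in `A`. -/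
def HADHull (A B : ObjectProperty TopCat.{u}) : ObjectProperty TopCat.{u} := hull (IsHADClass A) B

/-- The coreflective hull `CH(B)` of `B` in the category of topological spaces. -/
def CH (B : ObjectProperty TopCat.{u}) : ObjectProperty TopCat.{u} := hull IsCoreflective B

/-- The hereditary coreflective hull `SCH(B)` of `B` in the category of topological spaces. -/
def SCH (B : ObjectProperty TopCat.{u}) : ObjectProperty TopCat.{u} :=
  hull IsHereditaryCoreflective B

/-- The two-point indiscrete space. -/
def twoPointIndiscrete : TopCat.{u} := @TopCat.of (ULift.{u} Bool) ⊤

/-- A prime space: a space with precisely one accumulation point. -/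
def IsPrimeSpace (X : TopCat.{u}) : Prop := ∃! a : X, AccPt a (𝓟 Set.univ)

/-! The coreflective hull of `B` is `generatedBy B`, the class of quotients of sums. Embeddings are
stable under pushout along quotient maps, so the subspaces of these spaces form a coreflective class
again, which is therefore `SCH B`. It meets `A` in an HAD-class because `A` is hereditary and
additive.

The hard half is minimality, `IsHADClass.subspacesOf_generatedBy_le`. Let `C` be an HAD-class with a
prime space, and let `X` in `A` be embedded in a quotient `Y` of a sum of spaces from `C`. Two
things obstruct: `Y` may lie outside `A`, where divisibility says nothing, and quotient maps need
not restrict to quotient maps over `X`. Both disappear when the sum is replaced by a tree,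
`pathSpace`, glued from prime factors of the summands. The tree maps onto `Y` by an open continuous
map, and open maps do restrict; it lies in `A`, hence in `C`. The preimage of `X` is then in `C` and
has `X` as a quotient.

This needs `C` to be closed under prime factors, which is where the given prime space enters
(`IsHADClass.primeFactor_mem`), and the glued spaces to lie in `A`. For the latter, either `A`
contains all T₀-spaces, or its members are T₁ and the glued spaces have enough clopen sets. -/

/-! ### Coreflective subcategories -/

/-- The spaces whose topology is the final one with respect to all continuous maps from spaces
in `C`. -/
def generatedBy (C : ObjectProperty TopCat.{u}) : ObjectProperty TopCat.{u} :=
  fun T => ∀ U : Set T,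
    (∀ Z : TopCat.{u}, C Z → ∀ f : Z → T, Continuous f → IsOpen (f ⁻¹' U)) → IsOpen U

lemma le_generatedBy (C : ObjectProperty TopCat.{u}) : C ≤ generatedBy C :=
  fun T hT _ hU => hU T hT id continuous_id

lemma generatedBy_mono {C D : ObjectProperty TopCat.{u}} (h : C ≤ D) :
    generatedBy C ≤ generatedBy D :=
  fun _ hT _ hU => hT _ fun _ hZ => hU _ (h _ hZ)

lemma generatedBy_idem (C : ObjectProperty TopCat.{u}) :
    generatedBy (generatedBy C) ≤ generatedBy C :=
  fun _ hT _ hU => hT _ fun _ hZ f hf => hZ _ fun _ hW g hg => hU _ hW (f ∘ g) (hf.comp hg)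

lemma generatedBy_of_isQuotientMap {C : ObjectProperty TopCat.{u}} {X T : TopCat.{u}}
    (hX : generatedBy C X) {q : X → T} (hq : IsQuotientMap q) : generatedBy C T :=
  generatedBy_idem C T fun _ hU => hq.isOpen_preimage.1 (hU X hX q hq.continuous)

lemma generatedBy_sigma {C : ObjectProperty TopCat.{u}} {ι : Type u} {Y : ι → TopCat.{u}}
    (hY : ∀ i, C (Y i)) : generatedBy C (TopCat.of (Σ i, Y i)) :=
by
  refine fun U hU => isOpen_sigma_iff.2 fun i => ?_
  have hc : Continuous fun y : Y i => (⟨i, y⟩ : Σ i, Y i) :=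
    continuous_sigmaMk (σ := fun i => (Y i : Type u)) (i := i)
  exact hU (Y i) (hY i) _ hc

/-- All maps from `C` into `T` form a proper class. One witness for each non-open set is enough to
detect the topology, and one constant map for each point makes the sum surject. -/
lemma exists_isQuotientMap_of_generatedBy {C : ObjectProperty TopCat.{u}}
    (hC : ∃ Z : TopCat.{u}, C Z ∧ Nonempty Z) {T : TopCat.{u}} (hT : generatedBy C T) :
    ∃ (ι : Type u) (Y : ι → TopCat.{u}) (_ : ∀ i, C (Y i)) (q : (Σ i, Y i) → T),
      IsQuotientMap q := by
  obtain ⟨Z₀, hZ₀, ⟨z₀⟩⟩ := hC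
  have key : ∀ U : {U : Set T // ¬ IsOpen U}, ∃ Z : TopCat.{u}, C Z ∧ ∃ f : Z → T,
      Continuous f ∧ ¬ IsOpen (f ⁻¹' U.1) := by
    rintro ⟨U, hU⟩
    by_contra! h
    exact hU (hT U h)
  choose Z hZ f hf hfU using key
  let Y : {U : Set T // ¬ IsOpen U} ⊕ T → TopCat.{u} := Sum.elim Z fun _ => Z₀
  let q : ∀ i, Y i → T := fun i => match i with
    | .inl U => f U
    | .inr t => fun _ => t
  have hq : ∀ i, Continuous (q i) := by
    rintro (U | t)
    · exact hf U
    · exact continuous_const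
  refine ⟨_, Y, ?_, fun x => q x.1 x.2, ⟨isCoinducing_iff.2 fun U => ?_, fun t => ⟨⟨.inr t, z₀⟩, rfl⟩⟩⟩
  · rintro (U | t)
    exacts [hZ U, hZ₀]
  · refine ⟨fun h => ?_, fun h => h.preimage (continuous_sigma hq)⟩
    by_contra hU
    exact hfU ⟨U, hU⟩ (isOpen_sigma_iff.1 h (.inl ⟨U, hU⟩))

lemma generatedBy_of_quotientsOf_sumsOf {C : ObjectProperty TopCat.{u}} :
    quotientsOf (sumsOf C) ≤ generatedBy C := by
  rintro T ⟨X, ⟨ι, Y, hY, ⟨e⟩⟩, q, hq⟩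
  exact generatedBy_of_isQuotientMap (generatedBy_sigma hY)
    (q := q ∘ e.symm) (hq.comp e.symm.isQuotientMap)

lemma generatedBy_eq {C : ObjectProperty TopCat.{u}} (hC : ∃ Z : TopCat.{u}, C Z ∧ Nonempty Z) :
    generatedBy C = quotientsOf (sumsOf C) := by
  refine le_antisymm (fun T hT => ?_) generatedBy_of_quotientsOf_sumsOf
  obtain ⟨ι, Y, hY, q, hq⟩ := exists_isQuotientMap_of_generatedBy hC hT
  exact ⟨TopCat.of (Σ i, Y i), ⟨ι, Y, hY, ⟨Homeomorph.refl _⟩⟩, q, hq⟩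

lemma generatedBy_le_of_additive_of_divisible {A C : ObjectProperty TopCat.{u}}
    (hC : ∃ Z : TopCat.{u}, C Z ∧ Nonempty Z) (hadd : IsAdditive C) (hdiv : IsDivisibleIn A C) :
    generatedBy C ⊓ A ≤ C := by
  rintro T ⟨hT, hTA⟩
  rw [generatedBy_eq hC] at hT
  obtain ⟨X, hX, q, hq⟩ := hT
  exact hdiv T ⟨⟨X, hadd X hX, q, hq⟩, hTA⟩

/-- Existence and uniqueness of lifts of constant maps make the coreflection arrow bijective. It is
a quotient map when the topology of `T` is generated by `C`, hence a homeomorphism. -/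
lemma IsCoreflective.generatedBy_le {C : ObjectProperty TopCat.{u}} (hC : IsCoreflective C) :
    generatedBy C ≤ C := by
  intro T hT
  obtain ⟨R, c, hR, huniv⟩ := hC.exists_coreflection T
  obtain ⟨X₀, hX₀, hnt⟩ := hC.exists_nontrivial
  obtain ⟨x₀⟩ : Nonempty X₀ := inferInstance
  have hsurj : Function.Surjective c := by
    intro t
    obtain ⟨g, hg, -⟩ := huniv X₀ hX₀ (TopCat.ofHom ⟨fun _ => t, continuous_const⟩)
    exact ⟨g x₀, congrArg (fun k : X₀ ⟶ T => k x₀) hg⟩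
  have hinj : Function.Injective c := by
    intro x y hxy
    have := (huniv X₀ hX₀ (TopCat.ofHom ⟨fun _ => c x, continuous_const⟩)).unique
      (y₁ := TopCat.ofHom ⟨fun _ => x, continuous_const⟩)
      (y₂ := TopCat.ofHom ⟨fun _ => y, continuous_const⟩) rfl (by
        ext z
        exact hxy.symm)
    exact congrArg (fun k : X₀ ⟶ R => k x₀) this
  have hq : IsQuotientMap c := by
    refine ⟨isCoinducing_iff.2 fun U => ⟨fun h => ?_, fun h => h.preimage c.hom.continuous⟩, hsurj⟩
    refine hT U fun Z hZ f hf => ?_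
    obtain ⟨g, hg, -⟩ := huniv Z hZ (TopCat.ofHom ⟨f, hf⟩)
    have hfg : f = c ∘ g := by
      funext z
      exact (congrArg (fun k : Z ⟶ T => k z) hg).symm
    rw [hfg, Set.preimage_comp]
    exact h.preimage g.hom.continuous
  let e : R ≃ₜ T := (Equiv.ofBijective c ⟨hinj, hsurj⟩).toHomeomorph fun U =>
    hq.isOpen_preimage
  exact hC.iso_closed ⟨TopCat.isoOfHomeo e⟩ hR

lemma iso_closed_of_generatedBy_le {C : ObjectProperty TopCat.{u}} (hC : generatedBy C ≤ C)
    ⦃X Y : TopCat.{u}⦄ (h : Nonempty (X ≅ Y)) (hX : C X) : C Y := by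
  obtain ⟨e⟩ := h
  exact hC _ (generatedBy_of_isQuotientMap (le_generatedBy C X hX)
    (TopCat.homeoOfIso e).isQuotientMap)

/-- The final topology with respect to all continuous maps into `X` from spaces in `C`. -/
@[reducible]
def coreflectionTopology (C : ObjectProperty TopCat.{u}) (X : TopCat.{u}) : TopologicalSpace X where
  IsOpen U := ∀ Z : TopCat.{u}, C Z → ∀ f : Z → X, Continuous f → IsOpen (f ⁻¹' U)
  isOpen_univ _ _ _ _ := isOpen_univ
  isOpen_inter _ _ hU hV Z hZ f hf := (hU Z hZ f hf).inter (hV Z hZ f hf)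
  isOpen_sUnion S hS Z hZ f hf := by
    rw [Set.preimage_sUnion]
    exact isOpen_biUnion fun U hU => hS U hU Z hZ f hf

lemma isCoreflective_of_generatedBy_le {C : ObjectProperty TopCat.{u}} (hC : generatedBy C ≤ C)
    (hnt : ∃ X : TopCat.{u}, C X ∧ Nontrivial X) : IsCoreflective C where
  iso_closed := iso_closed_of_generatedBy_le hC
  exists_nontrivial := hnt
  exists_coreflection X := by
    let R : TopCat.{u} := @TopCat.of X (coreflectionTopology C X)
    have hcont : ∀ Z : TopCat.{u}, C Z → ∀ f : Z → X, Continuous f →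
        Continuous (Y := R) f :=
      fun Z hZ f hf => ⟨fun U hU => hU Z hZ f hf⟩
    have hc : Continuous (X := R) (Y := X) id :=
      ⟨fun U hU Z hZ f hf => IsOpen.preimage hf hU⟩
    let c : R ⟶ X := TopCat.ofHom (X := R) ⟨id, hc⟩
    refine ⟨R, c, hC R fun U hU Z hZ f hf => hU Z hZ f (hcont Z hZ f hf), fun Y hY f => ?_⟩
    refine ⟨TopCat.ofHom (Y := R) ⟨f, hcont Y hY f f.hom.continuous⟩, rfl, fun g hg => ?_⟩
    ext y
    exact congrArg (fun k : Y ⟶ X => k y) hg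

/-! ### Hereditary coreflective hulls -/

lemma le_subspacesOf (C : ObjectProperty TopCat.{u}) : C ≤ subspacesOf C :=
  fun X hX => ⟨X, hX, id, IsEmbedding.id⟩

lemma subspacesOf_mono {C D : ObjectProperty TopCat.{u}} (h : C ≤ D) :
    subspacesOf C ≤ subspacesOf D :=
  fun _ ⟨Y, hY, f, hf⟩ => ⟨Y, h Y hY, f, hf⟩

lemma isHereditary_subspacesOf (C : ObjectProperty TopCat.{u}) : IsHereditary (subspacesOf C) :=
  fun _ ⟨_, ⟨Z, hZ, g, hg⟩, f, hf⟩ => ⟨Z, hZ, g ∘ f, hg.comp hf⟩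

/-- The pushout of an embedding along a quotient map is an embedding. -/
lemma subspacesOf_of_isQuotientMap {C : ObjectProperty TopCat.{u}} (hC : generatedBy C ≤ C)
    {X T : TopCat.{u}} (hX : subspacesOf C X) {q : X → T} (hq : IsQuotientMap q) :
    subspacesOf C T := by
  classical
  obtain ⟨Y, hY, e, he⟩ := hX
  -- The pushout is realised on all of `T ⊕ Y`. The superfluous points `inr (e x)` are missed by
  -- `m`, so they are isolated and harmless.
  let m : Y → T ⊕ Y := fun y => if h : ∃ x, e x = y then .inl (q h.choose) else .inr y
  have hm : ∀ x, m (e x) = .inl (q x) := by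
    intro x
    have h : ∃ x', e x' = e x := ⟨x, rfl⟩
    have hx : h.choose = x := he.injective h.choose_spec
    simp only [m, dif_pos h, hx]
  have hm' : ∀ y, (¬ ∃ x, e x = y) → m y = .inr y := fun y h => by simp only [m, dif_neg h]
  let t : TopologicalSpace (T ⊕ Y) := TopologicalSpace.coinduced m inferInstance
  have hmc : @Continuous _ _ _ t m := continuous_coinduced_rng
  refine ⟨@TopCat.of (T ⊕ Y) t, hC _ fun U hU => ?_, Sum.inl, ?_⟩
  · exact isOpen_coinduced.2 (hU Y hY m hmc)
  · have hcont : @Continuous _ _ _ t (Sum.inl : T → T ⊕ Y) := by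
      refine hq.continuous_iff.2 ?_
      have : (Sum.inl : T → T ⊕ Y) ∘ q = m ∘ e := funext fun x => (hm x).symm
      rw [this]
      exact Continuous.comp hmc he.continuous
    refine @IsEmbedding.mk _ _ _ t _ (@IsInducing.mk _ _ _ t _ ?_) Sum.inl_injective
    refine le_antisymm (@Continuous.le_induced _ _ _ t _ hcont) fun U hU => ?_
    obtain ⟨V, hV, hVU⟩ := he.isOpen_iff.1 (hq.isOpen_preimage.2 hU)
    -- `U` and `V` agree along the glued part, so together they pull back to `V` under `m`.
    refine isOpen_induced_iff.2 ⟨Sum.elim (· ∈ U) (· ∈ V), isOpen_coinduced.2 ?_, rfl⟩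
    have : m ⁻¹' (Sum.elim (· ∈ U) (· ∈ V)) = V := by
      ext y
      by_cases h : ∃ x, e x = y
      · obtain ⟨x, rfl⟩ := h
        change Sum.elim (· ∈ U) (· ∈ V) (m (e x)) ↔ _
        rw [hm]
        exact (Set.ext_iff.1 hVU x).symm
      · change Sum.elim (· ∈ U) (· ∈ V) (m y) ↔ _
        rw [hm' y h]
        rfl
    rwa [this]

lemma subspacesOf_sigma {C : ObjectProperty TopCat.{u}} (hC : generatedBy C ≤ C)
    {ι : Type u} {X : ι → TopCat.{u}} (hX : ∀ i, subspacesOf C (X i)) :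
    subspacesOf C (TopCat.of (Σ i, X i)) := by
  choose Y hY e he using hX
  exact ⟨TopCat.of (Σ i, Y i), hC _ (generatedBy_sigma hY), Sigma.map id e,
    (isEmbedding_sigmaMap Function.injective_id).2 he⟩

/-- Sums and quotients of subspaces are subspaces of sums and quotients; hence one passage to
subspaces already gives the hereditary coreflective hull. -/
lemma generatedBy_subspacesOf_le {C : ObjectProperty TopCat.{u}} (hC : generatedBy C ≤ C)
    (hne : ∃ Z : TopCat.{u}, C Z ∧ Nonempty Z) :
    generatedBy (subspacesOf C) ≤ subspacesOf C := by
  intro T hT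
  obtain ⟨Z, hZ, hZn⟩ := hne
  obtain ⟨ι, Y, hY, q, hq⟩ :=
    exists_isQuotientMap_of_generatedBy ⟨Z, le_subspacesOf C Z hZ, hZn⟩ hT
  exact subspacesOf_of_isQuotientMap hC (subspacesOf_sigma hC hY) hq

lemma isAdditive_of_generatedBy_le {C : ObjectProperty TopCat.{u}} (hC : generatedBy C ≤ C) :
    IsAdditive C := by
  rintro X ⟨ι, Y, hY, ⟨e⟩⟩
  exact hC X (generatedBy_of_isQuotientMap (generatedBy_sigma hY) e.symm.isQuotientMap)

lemma hull_eq_of_isLeast {P : ObjectProperty TopCat.{u} → Prop} {B K : ObjectProperty TopCat.{u}}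
    (hK : IsLeast {C | P C ∧ B ≤ C} K) : hull P B = K :=
  le_antisymm (fun _ hX => hX K hK.1.1 hK.1.2) fun X hX _ hC hBC => hK.2 ⟨hC, hBC⟩ X hX

lemma isLeast_generatedBy {B : ObjectProperty TopCat.{u}}
    (hB : ∃ X : TopCat.{u}, B X ∧ Nontrivial X) :
    IsLeast {C | IsCoreflective C ∧ B ≤ C} (generatedBy B) := by
  obtain ⟨X, hX, hnt⟩ := hB
  exact ⟨⟨isCoreflective_of_generatedBy_le (generatedBy_idem B) ⟨X, le_generatedBy B X hX, hnt⟩,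
    le_generatedBy B⟩, fun C hC => (generatedBy_mono hC.2).trans hC.1.generatedBy_le⟩

lemma isLeast_subspacesOf_generatedBy {B : ObjectProperty TopCat.{u}}
    (hB : ∃ X : TopCat.{u}, B X ∧ Nontrivial X) :
    IsLeast {C | IsHereditaryCoreflective C ∧ B ≤ C} (subspacesOf (generatedBy B)) := by
  obtain ⟨X, hX, hnt⟩ := hB
  have hX' := le_generatedBy B X hX
  refine ⟨⟨⟨isCoreflective_of_generatedBy_le
    (generatedBy_subspacesOf_le (generatedBy_idem B) ⟨X, hX', inferInstance⟩)
    ⟨X, le_subspacesOf _ X hX', hnt⟩, isHereditary_subspacesOf _⟩,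
    (le_generatedBy B).trans (le_subspacesOf _)⟩, fun C hC => ?_⟩
  exact (subspacesOf_mono ((generatedBy_mono hC.2).trans hC.1.1.generatedBy_le)).trans hC.1.2

/-! ### Epireflective subcategories -/

/-- `U` is the preimage of an open set under a continuous map into a space from `A`. -/
def IsOpenVia (A : ObjectProperty TopCat.{u}) (X : TopCat.{u}) (U : Set X) : Prop :=
  ∃ Y : TopCat.{u}, A Y ∧ ∃ f : X → Y, Continuous f ∧ ∃ V : Set Y, IsOpen V ∧ f ⁻¹' V = U

namespace IsEpireflective

variable {A : ObjectProperty TopCat.{u}}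

/-- A space whose points are separated, and whose topology is generated, by its continuous maps
into spaces from `A` belongs to `A`. -/
lemma mem_of_initial (hA : IsEpireflective A) {X : TopCat.{u}}
    (hsep : ∀ x y : X, x ≠ y → ∃ Y : TopCat.{u}, A Y ∧ ∃ f : X → Y, Continuous f ∧ f x ≠ f y)
    (hopen : ∀ (x : X) (U : Set X), IsOpen U → x ∈ U → ∃ U₁ U₂ : Set X,
      IsOpenVia A X U₁ ∧ IsOpenVia A X U₂ ∧ x ∈ U₁ ∧ x ∈ U₂ ∧ U₁ ∩ U₂ ⊆ U) : A X := by
  obtain ⟨R, r, hR, hepi, huniv⟩ := hA.exists_reflection X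
  have hsurj : Function.Surjective r := (TopCat.epi_iff_surjective r).1 hepi
  have hfac : ∀ Y : TopCat.{u}, A Y → ∀ f : X → Y, Continuous f →
      ∃ g : R → Y, Continuous g ∧ ∀ x, g (r x) = f x := by
    intro Y hY f hf
    obtain ⟨g, hg, -⟩ := huniv Y hY (TopCat.ofHom ⟨f, hf⟩)
    exact ⟨g, g.hom.continuous, fun x => congrArg (fun k : X ⟶ Y => k x) hg⟩
  have hinj : Function.Injective r := by
    intro x y hxy
    by_contra hne
    obtain ⟨Y, hY, f, hf, hfne⟩ := hsep x y hne
    obtain ⟨g, -, hg⟩ := hfac Y hY f hf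
    exact hfne (by rw [← hg, ← hg, hxy])
  have hvia : ∀ U, IsOpenVia A X U → ∃ V : Set R, IsOpen V ∧ r ⁻¹' V = U := by
    rintro U ⟨Y, hY, f, hf, V, hV, rfl⟩
    obtain ⟨g, hgc, hg⟩ := hfac Y hY f hf
    refine ⟨g ⁻¹' V, hV.preimage hgc, ?_⟩
    ext x
    simp [hg]
  -- Sets open via `A` are preimages of open sets of the reflection, so the bijection `r` is open.
  have hopenMap : IsOpenMap r := by
    intro U hU
    refine isOpen_iff_mem_nhds.2 ?_
    rintro _ ⟨x, hx, rfl⟩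
    obtain ⟨U₁, U₂, h₁, h₂, hx₁, hx₂, hsub⟩ := hopen x U hU hx
    obtain ⟨V₁, hV₁, rfl⟩ := hvia U₁ h₁
    obtain ⟨V₂, hV₂, rfl⟩ := hvia U₂ h₂
    refine mem_of_superset ((hV₁.inter hV₂).mem_nhds ⟨hx₁, hx₂⟩) ?_
    rintro s ⟨hs₁, hs₂⟩
    obtain ⟨y, rfl⟩ := hsurj s
    exact ⟨y, hsub ⟨hs₁, hs₂⟩, rfl⟩
  let e : X ≃ₜ R := (Equiv.ofBijective r ⟨hinj, hsurj⟩).toHomeomorphOfContinuousOpen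
    r.hom.continuous hopenMap
  exact hA.iso_closed ⟨TopCat.isoOfHomeo e.symm⟩ hR

lemma hereditary (hA : IsEpireflective A) : IsHereditary A := by
  rintro X ⟨Y, hY, f, hf⟩
  refine hA.mem_of_initial
    (fun x y hxy => ⟨Y, hY, f, hf.continuous, hf.injective.ne hxy⟩) fun x U hU hx => ?_
  obtain ⟨V, hV, rfl⟩ := hf.isOpen_iff.1 hU
  have h : IsOpenVia A X (f ⁻¹' V) := ⟨Y, hY, f, hf.continuous, V, hV, rfl⟩
  exact ⟨_, _, h, h, hx, hx, Set.inter_subset_left⟩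

/-- Two distinct inseparable points would form an indiscrete subspace, and `A` is hereditary. -/
lemma t0Space (hA : IsEpireflective A) (hA₂ : ¬ A twoPointIndiscrete) {X : TopCat.{u}}
    (hX : A X) : T0Space X := by
  refine ⟨fun x y hxy => ?_⟩
  by_contra hne
  apply hA₂
  let f : ULift.{u} Bool → X := fun b => if b.down then x else y
  let t : TopologicalSpace (ULift.{u} Bool) := ⊤
  have hf : ∀ b, Inseparable x (f b) := by
    rintro ⟨_ | _⟩
    exacts [hxy, Inseparable.refl x]
  refine hA.hereditary _ ⟨X, hX, f, ⟨⟨?_⟩, ?_⟩⟩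
  · refine le_antisymm ?_ le_top
    intro U hU
    obtain ⟨V, hV, rfl⟩ := isOpen_induced_iff.1 hU
    by_cases hxV : x ∈ V
    · have : f ⁻¹' V = Set.univ := Set.eq_univ_of_forall fun b =>
        ((hf b).mem_open_iff hV).1 hxV
      exact (congrArg IsOpen[t] this).mpr (@isOpen_univ _ t)
    · have : f ⁻¹' V = ∅ := Set.eq_empty_of_forall_notMem fun b hb =>
        hxV (((hf b).mem_open_iff hV).2 hb)
      exact (congrArg IsOpen[t] this).mpr (@isOpen_empty _ t)
  · rintro ⟨_ | _⟩ ⟨_ | _⟩ h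
    · rfl
    · exact (hne h.symm).elim
    · exact (hne h).elim
    · rfl

/-- In a T₀-space the sets that generate the topology already separate points. -/
lemma mem_of_t0Space (hA : IsEpireflective A) {X : TopCat.{u}} [T0Space X]
    (hopen : ∀ (x : X) (U : Set X), IsOpen U → x ∈ U → ∃ U₁ U₂ : Set X,
      IsOpenVia A X U₁ ∧ IsOpenVia A X U₂ ∧ x ∈ U₁ ∧ x ∈ U₂ ∧ U₁ ∩ U₂ ⊆ U) : A X := by
  have key : ∀ (U : Set X), IsOpen U → ∀ x y, x ∈ U → y ∉ U →
      ∃ Y : TopCat.{u}, A Y ∧ ∃ f : X → Y, Continuous f ∧ f x ≠ f y := by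
    intro U hU x y hx hy
    obtain ⟨U₁, U₂, h₁, h₂, hx₁, hx₂, hsub⟩ := hopen x U hU hx
    have hy' : y ∉ U₁ ∨ y ∉ U₂ := by
      by_contra! h
      exact hy (hsub h)
    rcases hy' with hy' | hy'
    · obtain ⟨Y, hY, f, hf, V, -, rfl⟩ := h₁
      exact ⟨Y, hY, f, hf, fun h => hy' (h ▸ hx₁ : f y ∈ V)⟩
    · obtain ⟨Y, hY, f, hf, V, -, rfl⟩ := h₂
      exact ⟨Y, hY, f, hf, fun h => hy' (h ▸ hx₂ : f y ∈ V)⟩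
  refine hA.mem_of_initial (fun x y hxy => ?_) hopen
  obtain ⟨U, hU, h⟩ := exists_isOpen_xor_mem hxy
  rcases h with ⟨hx, hy⟩ | ⟨hy, hx⟩
  · exact key U hU x y hx hy
  · obtain ⟨Y, hY, f, hf, hne⟩ := key U hU y x hy hx
    exact ⟨Y, hY, f, hf, hne.symm⟩

/-- A nontrivial member of `A` might be the Sierpiński space, so a discrete pair need not be a
subspace of it. Maps that pull its open set `U` back to a single point are used instead. -/
lemma mem_discrete_two (hA : IsEpireflective A) (hA₂ : ¬ A twoPointIndiscrete) :
    A (TopCat.of (ULift.{u} Bool)) := by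
  obtain ⟨X, hX, hnt⟩ := hA.exists_nontrivial
  have := hA.t0Space hA₂ hX
  obtain ⟨x, y, hxy⟩ := exists_pair_ne X
  obtain ⟨U, hU, x, y, hx, hy⟩ : ∃ U : Set X, IsOpen U ∧ ∃ x y, x ∈ U ∧ y ∉ U := by
    obtain ⟨U, hU, h⟩ := exists_isOpen_xor_mem hxy
    rcases h with ⟨hx, hy⟩ | ⟨hy, hx⟩
    exacts [⟨U, hU, x, y, hx, hy⟩, ⟨U, hU, y, x, hy, hx⟩]
  refine hA.mem_of_t0Space fun b W _ hb => ?_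
  classical
  have h : IsOpenVia A (TopCat.of (ULift.{u} Bool)) {b} := by
    refine ⟨X, hX, fun c => if c = b then x else y, continuous_of_discreteTopology, U, hU, ?_⟩
    ext c
    by_cases hc : c = b <;> simp [hc, hx, hy]
  exact ⟨{b}, {b}, h, h, rfl, rfl, by simpa using hb⟩

lemma isOpenVia_of_isClopen (hA : IsEpireflective A) (hA₂ : ¬ A twoPointIndiscrete)
    {X : TopCat.{u}} {G : Set X} (hG : IsClopen G) : IsOpenVia A X G := by
  classical
  refine ⟨_, hA.mem_discrete_two hA₂, fun x => ⟨decide (x ∈ G)⟩, ?_, {⟨true⟩},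
    isOpen_discrete _, ?_⟩
  · refine continuous_uliftUp.comp ?_
    refine (continuous_bool_rng true).2 ?_
    convert hG using 1
    ext x
    simp
  · ext x
    simp

lemma mem_of_isClopen_basis (hA : IsEpireflective A) (hA₂ : ¬ A twoPointIndiscrete)
    {X : TopCat.{u}} [T0Space X]
    (hopen : ∀ (x : X) (U : Set X), IsOpen U → x ∈ U → ∃ G : Set X, IsClopen G ∧ x ∈ G ∧ G ⊆ U) :
    A X := by
  refine hA.mem_of_t0Space fun x U hU hx => ?_
  obtain ⟨G, hG, hxG, hGU⟩ := hopen x U hU hx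
  have h := hA.isOpenVia_of_isClopen hA₂ hG
  exact ⟨G, G, h, h, hxG, hxG, Set.inter_subset_left.trans hGU⟩

/-- Either `A` contains the Sierpiński space, and then all T₀-spaces, or `A` consists of
T₁-spaces. -/
lemma forall_t0Space_or_t1Space (hA : IsEpireflective A) (hA₂ : ¬ A twoPointIndiscrete) :
    (∀ X : TopCat.{u}, T0Space X → A X) ∨ ∀ X : TopCat.{u}, A X → T1Space X := by
  classical
  rw [or_iff_not_imp_right]
  intro h
  push Not at h
  obtain ⟨X, hX, hT1⟩ := h
  have := hA.t0Space hA₂ hX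
  rw [t1Space_iff_specializes_imp_eq] at hT1
  push Not at hT1
  obtain ⟨x, y, hxy, hne⟩ := hT1
  obtain ⟨W, hW, hxW, hyW⟩ : ∃ W : Set X, IsOpen W ∧ x ∈ W ∧ y ∉ W := by
    obtain ⟨W, hW, h⟩ := exists_isOpen_xor_mem hne
    rcases h with ⟨hx, hy⟩ | ⟨hy, hx⟩
    exacts [⟨W, hW, hx, hy⟩, (hx (hxy.mem_open hW hy)).elim]
  intro Z hZ
  refine hA.mem_of_t0Space fun z U hU hz => ?_
  have hvia : IsOpenVia A Z U := by
    -- Since `x ⤳ y`, the pair is a Sierpiński space with open point `x`, and this is the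
    -- characteristic map of `U`.
    refine ⟨X, hX, fun z => if z ∈ U then x else y, ⟨fun V hV => ?_⟩, W, hW, ?_⟩
    · by_cases hyV : y ∈ V
      · convert isOpen_univ
        refine Set.eq_univ_of_forall fun z => ?_
        by_cases hz : z ∈ U <;> simp [hz, hyV, hxy.mem_open hV hyV]
      · by_cases hxV : x ∈ V
        · convert hU
          ext z
          by_cases hz : z ∈ U <;> simp [hz, hyV, hxV]
        · convert isOpen_empty
          ext z
          by_cases hz : z ∈ U <;> simp [hz, hyV, hxV]
    · ext z
      by_cases hz : z ∈ U <;> simp [hz, hxW, hyW]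
  exact ⟨U, U, hvia, hvia, hz, hz, Set.inter_subset_left⟩

/-- An open set of one summand is the intersection of that clopen summand with a preimage under a
retraction onto it. This is one reason for allowing two sets in `mem_of_initial`. -/
lemma sigma_mem (hA : IsEpireflective A) (hA₂ : ¬ A twoPointIndiscrete)
    {ι : Type u} {Y : ι → TopCat.{u}} (hY : ∀ i, A (Y i)) : A (TopCat.of (Σ i, Y i)) := by
  classical
  have hclopen : ∀ i, IsClopen (Set.range fun y : Y i => (⟨i, y⟩ : Σ i, Y i)) :=
    fun i => isClopen_range_sigmaMk (X := fun i => (Y i : Type u)) (i := i)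
  have hretr : ∀ (i : ι) (x : Y i), ∃ f : (Σ i, Y i) → Y i, Continuous f ∧
      ∀ z, f ⟨i, z⟩ = z := by
    intro i x
    refine ⟨fun s => if h : s.1 = i then h ▸ s.2 else x, continuous_sigma fun j => ?_, by simp⟩
    by_cases h : j = i
    · subst h
      simp only [dite_true]
      exact continuous_id
    · simpa [h] using continuous_const
  refine hA.mem_of_initial ?_ ?_
  · rintro ⟨i, x⟩ ⟨j, y⟩ hne
    by_cases hij : i = j
    · subst hij
      obtain ⟨f, hf, hfz⟩ := hretr i x
      refine ⟨Y i, hY i, f, hf, ?_⟩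
      rw [hfz, hfz]
      rintro rfl
      exact hne rfl
    · obtain ⟨Z, hZ, f, hf, V, -, hV⟩ := hA.isOpenVia_of_isClopen hA₂
        (X := TopCat.of (Σ i, Y i)) (hclopen i)
      refine ⟨Z, hZ, f, hf, fun h => ?_⟩
      have h₁ : (⟨i, x⟩ : Σ i, Y i) ∈ f ⁻¹' V := hV ▸ ⟨x, rfl⟩
      have h₂ : (⟨j, y⟩ : Σ i, Y i) ∈ f ⁻¹' V := by
        change f _ ∈ V
        rw [← h]
        exact h₁
      rw [hV] at h₂
      obtain ⟨z, hz⟩ := h₂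
      exact hij (congrArg Sigma.fst hz)
  · rintro ⟨i, x⟩ U hU hx
    obtain ⟨f, hf, hfz⟩ := hretr i x
    refine ⟨f ⁻¹' ((fun y : Y i => (⟨i, y⟩ : Σ i, Y i)) ⁻¹' U), Set.range (fun y : Y i => (⟨i, y⟩ : Σ i, Y i)),
      ⟨Y i, hY i, f, hf, _, isOpen_sigma_iff.1 hU i, rfl⟩,
      hA.isOpenVia_of_isClopen hA₂ (X := TopCat.of (Σ i, Y i)) (hclopen i), ?_, ⟨x, rfl⟩, ?_⟩
    · change (⟨i, f ⟨i, x⟩⟩ : Σ i, Y i) ∈ U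
      rwa [hfz]
    · rintro _ ⟨hz, z, rfl⟩
      change (⟨i, f ⟨i, z⟩⟩ : Σ i, Y i) ∈ U at hz
      rwa [hfz] at hz

lemma additive (hA : IsEpireflective A) (hA₂ : ¬ A twoPointIndiscrete) : IsAdditive A := by
  rintro X ⟨ι, Y, hY, ⟨e⟩⟩
  exact hA.iso_closed ⟨(TopCat.isoOfHomeo (Y := TopCat.of (Σ i, Y i)) e).symm⟩ (hA.sigma_mem hA₂ hY)

end IsEpireflective

/-! ### Prime factors -/

lemma IsPrimeSpace.exists_point {P : TopCat.{u}} (hP : IsPrimeSpace P) :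
    ∃ p : P, (𝓝[≠] p).NeBot ∧ ∀ x, x ≠ p → IsOpen ({x} : Set P) := by
  obtain ⟨p, hp, huniq⟩ := hP
  refine ⟨p, by simpa [AccPt] using hp, fun x hx => ?_⟩
  rw [isOpen_singleton_iff_punctured_nhds]
  by_contra h
  exact hx (huniq x (by simpa [AccPt] using neBot_iff.2 h))

lemma isOpen_of_notMem_of_isolated {P : Type*} [TopologicalSpace P] {p : P}
    (hP : ∀ x, x ≠ p → IsOpen ({x} : Set P)) {N : Set P} (hN : p ∉ N) : IsOpen N := by
  rw [← Set.biUnion_of_singleton N]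
  exact isOpen_biUnion fun x hx => hP x fun h => hN (h ▸ hx)

lemma IsPrimeSpace.nontrivial {P : TopCat.{u}} (hP : IsPrimeSpace P) : Nontrivial P := by
  obtain ⟨p, hp, -⟩ := hP.exists_point
  obtain ⟨x, hx⟩ := hp.nonempty_of_mem self_mem_nhdsWithin
  exact ⟨x, p, hx⟩

/-- The prime factor of `Z` at `a`: the neighbourhoods of `a` are those in `Z`, and all other
points are isolated. -/
def primeFactor (Z : TopCat.{u}) (a : Z) : TopCat.{u} := @TopCat.of Z (nhdsAdjoint a (𝓝 a))

/-- The space obtained from `Z` by gluing a copy of `P` to each point `z` of `Z`, at the point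
`p` of `P`; the point `z` itself is represented by `(z, p)`. -/
def attach (Z P : TopCat.{u}) (p : P) : TopCat.{u} :=
  @TopCat.of (Z × P)
    { IsOpen := fun W => IsOpen {z | (z, p) ∈ W} ∧ ∀ z, IsOpen {x | (z, x) ∈ W}
      isOpen_univ := ⟨isOpen_univ, fun _ => isOpen_univ⟩
      isOpen_inter := fun _ _ hU hV => ⟨hU.1.inter hV.1, fun z => (hU.2 z).inter (hV.2 z)⟩
      isOpen_sUnion := fun S hS => by
        constructor
        · convert isOpen_biUnion (s := S) (f := fun W => {z | (z, p) ∈ W}) fun W hW => (hS W hW).1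
          ext z
          simp
        · intro z
          convert isOpen_biUnion (s := S) (f := fun W => {x | (z, x) ∈ W}) fun W hW => (hS W hW).2 z
          ext x
          simp }

lemma isOpen_primeFactor {Z : TopCat.{u}} {a : Z} {U : Set (primeFactor Z a)} :
    IsOpen U ↔ (a ∈ (show Set Z from U) → (show Set Z from U) ∈ 𝓝 a) := Iff.rfl

lemma isOpen_attach {Z P : TopCat.{u}} {p : P} {W : Set (attach Z P p)} :
    IsOpen W ↔ IsOpen {z : Z | (z, p) ∈ (show Set (Z × P) from W)} ∧
      ∀ z : Z, IsOpen {x : P | (z, x) ∈ (show Set (Z × P) from W)} := Iff.rfl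

lemma continuous_attach_fst {Z P : TopCat.{u}} {p : P} :
    Continuous (X := attach Z P p) (Y := Z) (fun m => (show Z × P from m).1) := by
  refine ⟨fun V hV => isOpen_attach.2 ⟨hV, fun z => ?_⟩⟩
  by_cases hz : z ∈ V
  · convert isOpen_univ
    exact Set.eq_univ_of_forall fun x => hz
  · convert isOpen_empty
    exact Set.eq_empty_of_forall_notMem fun x => hz

lemma isOpen_attach_singleton {Z P : TopCat.{u}} {p : P}
    (hP : ∀ x, x ≠ p → IsOpen ({x} : Set P)) {z : Z} {x : P} (hx : x ≠ p) :
    IsOpen ({((z, x) : Z × P)} : Set (attach Z P p)) := by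
  refine isOpen_attach.2 ⟨?_, fun z' => isOpen_of_notMem_of_isolated hP ?_⟩
  · convert isOpen_empty
    refine Set.eq_empty_of_forall_notMem fun z' h => hx ?_
    exact (congrArg Prod.snd (show (z', p) = (z, x) from h)).symm
  · intro h
    exact hx (congrArg Prod.snd (show (z', p) = (z, x) from h)).symm

lemma t0Space_attach {Z P : TopCat.{u}} {p : P} (hP : ∀ x, x ≠ p → IsOpen ({x} : Set P))
    [T0Space Z] : T0Space (attach Z P p) := by
  refine ⟨?_⟩
  have key : ∀ (z : Z) (x y : P), x ≠ p →
      Inseparable (X := attach Z P p) ((z, x) : Z × P) ((z, y) : Z × P) → x = y := by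
    intro z x y hx h
    have := (h.mem_open_iff (isOpen_attach_singleton hP hx)).1 rfl
    exact (congrArg Prod.snd (show (z, y) = (z, x) from this)).symm
  rintro ⟨z, x⟩ ⟨w, y⟩ h
  obtain rfl : z = w := (h.map continuous_attach_fst).eq
  by_cases hx : x = p
  · by_cases hy : y = p
    · rw [hx, hy]
    · rw [key z y x hy h.symm]
  · rw [key z x y hx h]

namespace IsEpireflective

variable {A : ObjectProperty TopCat.{u}}

/-- Every set missing `a` is open, so open neighbourhoods of `a` are clopen; if `Z` is T₁, the other
singletons are clopen too. -/
lemma primeFactor_mem (hA : IsEpireflective A) (hA₂ : ¬ A twoPointIndiscrete) {Z : TopCat.{u}}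
    (hZ : A Z) (a : Z) : A (primeFactor Z a) := by
  have hne : ∀ U : Set (primeFactor Z a), a ∉ (show Set Z from U) → IsOpen U :=
    fun U hU => isOpen_primeFactor.2 fun h => (hU h).elim
  have hT0 : T0Space (primeFactor Z a) := by
    refine ⟨?_⟩
    have key : ∀ x y : Z, x ≠ a → Inseparable (X := primeFactor Z a) x y → x = y :=
      fun x y hx h => ((h.mem_open_iff (hne {x} (Ne.symm hx))).1 rfl).symm
    intro x y h
    by_cases hx : x = a
    · by_cases hy : y = a
      · exact hx.trans hy.symm
      · exact (key y x hy h.symm).symm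
    · exact key x y hx h
  rcases hA.forall_t0Space_or_t1Space hA₂ with hall | hT1
  · exact hall _ hT0
  · have := hT1 Z hZ
    refine hA.mem_of_isClopen_basis hA₂ fun x U hU hx => ?_
    by_cases hxa : x = a
    · have ha : a ∈ (show Set Z from U) := hxa ▸ hx
      exact ⟨U, ⟨⟨hne _ fun h => h ha⟩, hU⟩, hx, subset_rfl⟩
    · refine ⟨{x}, ⟨⟨isOpen_primeFactor.2 fun _ => ?_⟩, hne _ (Ne.symm hxa)⟩, rfl, by simpa using hx⟩
      exact isOpen_compl_singleton.mem_nhds (Ne.symm hxa)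

lemma attach_mem (hA : IsEpireflective A) (hA₂ : ¬ A twoPointIndiscrete) {Z P : TopCat.{u}}
    (hZ : A Z) (hPA : A P) {p : P} (hP : ∀ x, x ≠ p → IsOpen ({x} : Set P)) :
    A (attach Z P p) := by
  have := hA.t0Space hA₂ hZ
  have hT0 : T0Space (attach Z P p) := t0Space_attach hP
  rcases hA.forall_t0Space_or_t1Space hA₂ with hall | hT1
  · exact hall _ hT0
  have := hT1 P hPA
  refine hA.mem_of_t0Space ?_
  rintro ⟨z, x⟩ W hW hx
  by_cases hxp : x = p
  · subst hxp
    let V : Set Z := {z | (z, x) ∈ (show Set (Z × P) from W)}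
    -- `Z` need not be zero-dimensional, so `V` is pulled back along the projection to `Z`, and `G`
    -- only trims the glued copies. It contains every gluing point, so its complement consists of
    -- isolated points.
    let G : Set (attach Z P x) := fun m : Z × P => m.1 ∈ V → m ∈ (show Set (Z × P) from W)
    have hG : IsClopen G := by
      refine ⟨⟨isOpen_attach.2 ⟨?_, fun z' => isOpen_of_notMem_of_isolated hP fun h => h fun h' => h'⟩⟩,
        isOpen_attach.2 ⟨?_, fun z' => ?_⟩⟩
      · convert isOpen_empty
        exact Set.eq_empty_of_forall_notMem fun z' h => h fun h' => h'
      · convert isOpen_univ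
        exact Set.eq_univ_of_forall fun z' h => h
      · by_cases hz' : z' ∈ V
        · convert (isOpen_attach.1 hW).2 z' using 1
          ext y
          exact ⟨fun h => h hz', fun h _ => h⟩
        · convert isOpen_univ
          exact Set.eq_univ_of_forall fun y h => (hz' h).elim
    refine ⟨_, G, ⟨Z, hZ, _, continuous_attach_fst, V, (isOpen_attach.1 hW).1, rfl⟩,
      hA.isOpenVia_of_isClopen hA₂ hG, hx, fun _ => hx, ?_⟩
    exact fun m hm => hm.2 hm.1
  · have h := hA.isOpenVia_of_isClopen hA₂
      (G := ({((z, x) : Z × P)} : Set (attach Z P p)))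
      ⟨⟨isOpen_attach.2 ⟨?_, fun z' => ?_⟩⟩, isOpen_attach_singleton hP hxp⟩
    · refine ⟨_, _, h, h, rfl, rfl, ?_⟩
      rintro _ ⟨rfl, -⟩
      exact hx
    · convert isOpen_univ
      refine Set.eq_univ_of_forall fun z' h => hxp ?_
      exact (congrArg Prod.snd (show (z', p) = (z, x) from h)).symm
    · by_cases hz' : z' = z
      · subst hz'
        convert isOpen_compl_singleton (x := x) using 1
        ext y
        exact not_congr ⟨fun h => congrArg Prod.snd (show (z', y) = (z', x) from h),
          fun h => congrArg (Prod.mk z') h⟩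
      · convert isOpen_univ
        exact Set.eq_univ_of_forall fun y h =>
          hz' (congrArg Prod.fst (show (z', y) = (z, x) from h))

end IsEpireflective

namespace IsHADClass

variable {A C : ObjectProperty TopCat.{u}}

lemma mem_of_generatedBy (hC : IsHADClass A C) {T : TopCat.{u}} (hTA : A T)
    (hT : generatedBy C T) : C T := by
  obtain ⟨X, hX, _⟩ := hC.exists_nontrivial
  exact generatedBy_le_of_additive_of_divisible ⟨X, hX, inferInstance⟩ hC.additive hC.divisible T
    ⟨hT, hTA⟩

/-- The topology of the glued space is final for the inclusions of `Z` and of the copies of `P`. -/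
lemma attach_mem (hC : IsHADClass A C) (hA : IsEpireflective A) (hA₂ : ¬ A twoPointIndiscrete)
    {Z P : TopCat.{u}} (hZ : C Z) (hPC : C P) {p : P} (hP : ∀ x, x ≠ p → IsOpen ({x} : Set P)) :
    C (attach Z P p) := by
  refine hC.mem_of_generatedBy (hA.attach_mem hA₂ (hC.le _ hZ) (hC.le _ hPC) hP) fun U hU => ?_
  refine isOpen_attach.2 ⟨hU Z hZ (fun z => (z, p)) ⟨fun W hW => (isOpen_attach.1 hW).1⟩,
    fun z => hU P hPC (fun x => (z, x)) ⟨fun W hW => (isOpen_attach.1 hW).2 z⟩⟩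

/-- An HAD-class that contains a prime space is closed under prime factors. -/
lemma primeFactor_mem (hC : IsHADClass A C) (hA : IsEpireflective A)
    (hA₂ : ¬ A twoPointIndiscrete) {P : TopCat.{u}} (hPC : C P) (hP : IsPrimeSpace P)
    {Z : TopCat.{u}} (hZ : C Z) (a : Z) : C (primeFactor Z a) := by
  obtain ⟨p, hp, hiso⟩ := hP.exists_point
  -- Over each `z ≠ a` only the isolated points of the copy of `P` are kept. They still cluster at
  -- the deleted point `(z, p)`, so neighbourhoods of `(a, p)` remember those of `a` in `Z`.
  let S : Set (attach Z P p) :=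
    fun m : Z × P => m = (a, p) ∨ (m.1 ≠ a ∧ m.2 ≠ p)
  have hS : C (TopCat.of S) :=
    hC.hereditary _ ⟨_, hC.attach_mem hA hA₂ hZ hPC hiso, Subtype.val, IsEmbedding.subtypeVal⟩
  let f : S → primeFactor Z a := fun m => (show Z × P from m.1).1
  have hf : Continuous f := by
    refine ⟨fun W hW => ?_⟩
    let W' : Set Z := W
    have hW' : a ∈ W' → W' ∈ 𝓝 a := hW
    -- `W'` need not be open in `Z`, so gluing points are admitted only over its interior, which
    -- contains `a` whenever `W'` does.
    let O : Set (attach Z P p) := fun m : Z × P => (m.2 ≠ p ∧ m.1 ∈ W') ∨ m.1 ∈ interior W'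
    have hO : IsOpen O := by
      refine isOpen_attach.2 ⟨?_, fun z => ?_⟩
      · convert isOpen_interior (s := W') using 1
        ext z
        exact ⟨fun h => h.elim (fun h => (h.1 rfl).elim) id, Or.inr⟩
      · by_cases hz : z ∈ interior W'
        · convert isOpen_univ
          exact Set.eq_univ_of_forall fun x => Or.inr hz
        · exact isOpen_of_notMem_of_isolated hiso fun h => h.elim (fun h => h.1 rfl) hz
    refine isOpen_induced_iff.2 ⟨O, hO, ?_⟩
    ext ⟨⟨z, x⟩, hm⟩
    constructor
    · exact fun h => h.elim (fun h => h.2) fun h => interior_subset (s := W') h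
    · intro h
      rcases hm with hm | hm
      · obtain ⟨rfl, rfl⟩ := Prod.mk.inj hm
        exact Or.inr (mem_interior_iff_mem_nhds.2 (hW' h))
      · exact Or.inl ⟨hm.2, h⟩
  refine hC.mem_of_generatedBy (hA.primeFactor_mem hA₂ (hC.le _ hZ) a) fun U hU => ?_
  refine isOpen_primeFactor.2 fun haU => ?_
  obtain ⟨O, hO, hOU⟩ := isOpen_induced_iff.1 (hU _ hS f hf)
  have hmem : ∀ m : S, m.1 ∈ O ↔ f m ∈ U := fun m => Set.ext_iff.1 hOU m
  obtain ⟨hO₁, hO₂⟩ := isOpen_attach.1 hO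
  have haO : (a, p) ∈ (show Set (Z × P) from O) := (hmem ⟨(a, p), Or.inl rfl⟩).2 haU
  refine mem_of_superset (hO₁.mem_nhds haO) fun z hz => ?_
  by_cases hza : z = a
  · exact hza ▸ haU
  · have hx : {x : P | (z, x) ∈ (show Set (Z × P) from O)} ∈ 𝓝[≠] p :=
      mem_nhdsWithin_of_mem_nhds ((hO₂ z).mem_nhds hz)
    -- As `p` is not isolated, an open set containing the deleted point `(z, p)` meets `S` over `z`.
    obtain ⟨x, hxO, hxp⟩ := hp.nonempty_of_mem (inter_mem hx self_mem_nhdsWithin)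
    exact (hmem ⟨(z, x), Or.inr ⟨hza, hxp⟩⟩).1 hxO

end IsHADClass

/-! ### Tree spaces -/

section Tree

variable {ι : Type u} (Q : ι → TopCat.{u}) (p : ∀ i, Q i) (Y : TopCat.{u}) (q : ∀ i, Q i → Y)

/-- The end point in `Y` of a path that starts at a point of `Y` and then runs through points of
the spaces `Q i`. -/
def pathEnd : Y × List (Σ i, Q i) → Y
  | (y, []) => y
  | (_, s :: _) => q s.1 s.2

/-- The space of paths, with a copy of `Q i` glued to every path that ends at `q i (p i)`, at the
point `p i`. -/
def pathSpace : TopCat.{u} :=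
  @TopCat.of (Y × List (Σ i, Q i))
    { IsOpen := fun U => ∀ t ∈ U, ∀ i, q i (p i) = pathEnd Q Y q t →
        ∀ᶠ x in 𝓝 (p i), x ≠ p i → (t.1, ⟨i, x⟩ :: t.2) ∈ U
      isOpen_univ := fun _ _ _ _ => Eventually.of_forall fun _ _ => trivial
      isOpen_inter := fun U V hU hV t ht i hi => by
        filter_upwards [hU t ht.1 i hi, hV t ht.2 i hi] with x hxU hxV hne
        exact ⟨hxU hne, hxV hne⟩
      isOpen_sUnion := fun S hS t ⟨U, hUS, htU⟩ i hi => by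
        filter_upwards [hS U hUS t htU i hi] with x hx hne
        exact ⟨U, hUS, hx hne⟩ }

variable {Q p Y q}

lemma isOpen_pathSpace {U : Set (pathSpace Q p Y q)} :
    IsOpen U ↔ ∀ t : Y × List (Σ i, Q i), t ∈ (show Set (Y × List (Σ i, Q i)) from U) →
      ∀ i, q i (p i) = pathEnd Q Y q t → ∀ᶠ x in 𝓝 (p i), x ≠ p i →
        (t.1, ⟨i, x⟩ :: t.2) ∈ (show Set (Y × List (Σ i, Q i)) from U) := Iff.rfl

lemma continuous_pathEnd (hq : ∀ i, Continuous (q i)) :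
    Continuous (X := pathSpace Q p Y q) (pathEnd Q Y q) := by
  refine ⟨fun W hW => isOpen_pathSpace.2 fun t ht i hi => ?_⟩
  have hp : q i (p i) ∈ W := hi ▸ ht
  filter_upwards [(hW.preimage (hq i)).mem_nhds hp] with x hx _
  exact hx

/-- A path in `U` ending at `q i (p i)` carries its own copy of `Q i`, so its extensions inside `U`
already cover the image of a neighbourhood of `p i`. -/
lemma isOpenMap_pathEnd (hiso : ∀ i x, x ≠ p i → IsOpen ({x} : Set (Q i)))
    (hq : ∀ U : Set Y, (∀ i, IsOpen (q i ⁻¹' U)) → IsOpen U) :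
    IsOpenMap (X := pathSpace Q p Y q) (pathEnd Q Y q) := by
  intro U hU
  refine hq _ fun i => ?_
  by_cases hp : p i ∈ q i ⁻¹' (pathEnd Q Y q '' U)
  · refine isOpen_iff_mem_nhds.2 fun x hx => ?_
    by_cases hxp : x = p i
    · subst hxp
      obtain ⟨t, htU, ht⟩ := hp
      filter_upwards [isOpen_pathSpace.1 hU t htU i ht.symm] with x hx'
      by_cases hxp : x = p i
      · exact hxp ▸ hx
      · exact ⟨_, hx' hxp, rfl⟩
    · exact mem_of_superset ((hiso i x hxp).mem_nhds rfl) (by simpa using hx)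
  · exact isOpen_of_notMem_of_isolated (hiso i) hp

/-- The glued copies of the `Q i` determine the topology: `f` is the inclusion of the copy attached
at `t`. -/
lemma generatedBy_pathSpace {C : ObjectProperty TopCat.{u}} (hQ : ∀ i, C (Q i))
    (hiso : ∀ i x, x ≠ p i → IsOpen ({x} : Set (Q i))) : generatedBy C (pathSpace Q p Y q) := by
  classical
  intro U hU
  refine isOpen_pathSpace.2 fun t ht i hi => ?_
  let f : Q i → pathSpace Q p Y q :=
    fun x => if x = p i then t else (show Y × List (Σ i, Q i) from (t.1, ⟨i, x⟩ :: t.2))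
  have hfp : f (p i) = t := if_pos rfl
  have hfx : ∀ x, x ≠ p i → f x = (show Y × List (Σ i, Q i) from (t.1, ⟨i, x⟩ :: t.2)) :=
    fun x hx => if_neg hx
  have hf : Continuous f := by
    refine ⟨fun V hV => ?_⟩
    by_cases hp : p i ∈ f ⁻¹' V
    · refine isOpen_iff_mem_nhds.2 fun x hx => ?_
      by_cases hxp : x = p i
      · subst hxp
        have htV : t ∈ V := hfp ▸ hp
        filter_upwards [isOpen_pathSpace.1 hV t htV i hi] with x hx'
        by_cases hxp : x = p i
        · exact hxp ▸ hx
        · change f x ∈ V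
          rw [hfx x hxp]
          exact hx' hxp
      · exact mem_of_superset ((hiso i x hxp).mem_nhds rfl) (by simpa using hx)
    · exact isOpen_of_notMem_of_isolated (hiso i) hp
  have hpU : p i ∈ f ⁻¹' U := by
    change f (p i) ∈ U
    rw [hfp]
    exact ht
  filter_upwards [(hU (Q i) (hQ i) f hf).mem_nhds hpU] with x hx hxp
  have hx' : f x ∈ U := hx
  rw [hfx x hxp] at hx'
  exact hx'

/-- The extensions of a path form an open set, so inseparable paths extend each other. -/
lemma t0Space_pathSpace : T0Space (pathSpace Q p Y q) := by
  have key : ∀ t s : Y × List (Σ i, Q i), Inseparable (X := pathSpace Q p Y q) t s →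
      ∃ l, s = (t.1, l ++ t.2) := by
    intro t s h
    have hD : IsOpen (X := pathSpace Q p Y q)
        {s : Y × List (Σ i, Q i) | ∃ l, s = (t.1, l ++ t.2)} := by
      refine isOpen_pathSpace.2 ?_
      rintro _ ⟨l, rfl⟩ i -
      exact Eventually.of_forall fun x _ => ⟨⟨i, x⟩ :: l, rfl⟩
    exact (h.mem_open_iff hD).1 ⟨[], rfl⟩
  refine ⟨fun t s h => ?_⟩
  obtain ⟨l, hl⟩ := key t s h
  obtain ⟨l', hl'⟩ := key s t h.symm
  have h₁ := congrArg (fun r : Y × List (Σ i, Q i) => r.2.length) hl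
  have h₂ := congrArg (fun r : Y × List (Σ i, Q i) => r.2.length) hl'
  simp only [List.length_append] at h₁ h₂
  obtain rfl : l = [] := List.eq_nil_of_length_eq_zero (by omega)
  exact hl.symm

/-- The paths that extend `t` and whose initial segments between `t` and the path itself lie
in `U`. -/
inductive PathWithin (U : Set (Y × List (Σ i, Q i))) (t : Y × List (Σ i, Q i)) :
    Y × List (Σ i, Q i) → Prop
  | refl : PathWithin U t t
  | step (s : Y × List (Σ i, Q i)) (e : Σ i, Q i) :
      PathWithin U t s → (s.1, e :: s.2) ∈ U → PathWithin U t (s.1, e :: s.2)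

lemma PathWithin.mem {U : Set (Y × List (Σ i, Q i))} {t s : Y × List (Σ i, Q i)}
    (h : PathWithin U t s) (ht : t ∈ U) : s ∈ U := by
  cases h with
  | refl => exact ht
  | step s e _ hU => exact hU

/-- Any member other than `t` has its predecessor in the set. Hence a path outside the set has at
most one one-step extension inside it, namely `t`, and the T₁ axiom keeps that one away from the
gluing point. -/
lemma isClopen_pathWithin [∀ i, T1Space (Q i)] {U : Set (pathSpace Q p Y q)} (hU : IsOpen U)
    {t : Y × List (Σ i, Q i)} (ht : t ∈ (show Set (Y × List (Σ i, Q i)) from U)) :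
    IsClopen (X := pathSpace Q p Y q) {s | PathWithin U t s} := by
  refine ⟨⟨isOpen_pathSpace.2 fun s hs i _ => ?_⟩, isOpen_pathSpace.2 fun s hs i hi => ?_⟩
  · have hev : ∀ᶠ x in 𝓝 (p i), x ≠ p i → (s.1, (⟨i, x⟩ : Σ i, Q i) :: s.2) ≠ t := by
      by_cases h : ∃ x₀, x₀ ≠ p i ∧ (s.1, (⟨i, x₀⟩ : Σ i, Q i) :: s.2) = t
      · obtain ⟨x₀, hx₀, rfl⟩ := h
        filter_upwards [isOpen_compl_singleton.mem_nhds (Ne.symm hx₀)] with x hx _ heq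
        simp only [Prod.mk.injEq, true_and, List.cons.injEq, and_true, Sigma.mk.injEq,
          heq_eq_eq] at heq
        exact hx heq
      · push Not at h
        exact Eventually.of_forall h
    filter_upwards [hev] with x hx hxp hmem
    have hx := hx hxp
    generalize hr : (s.1, (⟨i, x⟩ : Σ i, Q i) :: s.2) = r at hx hmem
    have hmem' : PathWithin U t r := hmem
    cases hmem' with
    | refl => exact hx rfl
    | step s' e hs' _ =>
      obtain rfl : s = s' := by
        simp only [Prod.mk.injEq, List.cons.injEq] at hr
        exact Prod.ext hr.1 hr.2.2
      exact hs hs'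
  · have hsU : s ∈ (show Set (Y × List (Σ i, Q i)) from U) := PathWithin.mem hs ht
    filter_upwards [isOpen_pathSpace.1 hU s hsU i hi] with x hx hxp
    exact PathWithin.step s ⟨i, x⟩ hs (hx hxp)

lemma IsEpireflective.pathSpace_mem {A : ObjectProperty TopCat.{u}} (hA : IsEpireflective A)
    (hA₂ : ¬ A twoPointIndiscrete) (hQ : ∀ i, A (Q i)) : A (pathSpace Q p Y q) := by
  have hT0 : T0Space (pathSpace Q p Y q) := t0Space_pathSpace
  rcases hA.forall_t0Space_or_t1Space hA₂ with hall | hT1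
  · exact hall _ hT0
  · have : ∀ i, T1Space (Q i) := fun i => hT1 _ (hQ i)
    exact hA.mem_of_isClopen_basis hA₂ fun t U hU ht =>
      ⟨_, isClopen_pathWithin hU ht, PathWithin.refl, fun s hs => PathWithin.mem hs ht⟩

end Tree

/-! ### The HAD-hull -/

/-- An HAD-class in `A` that contains a prime space contains every space from `A` that is a
subspace of a space from its coreflective hull. -/
lemma IsHADClass.subspacesOf_generatedBy_le {A C : ObjectProperty TopCat.{u}}
    (hC : IsHADClass A C) (hA : IsEpireflective A) (hA₂ : ¬ A twoPointIndiscrete)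
    {P : TopCat.{u}} (hPC : C P) (hP : IsPrimeSpace P) :
    subspacesOf (generatedBy C) ⊓ A ≤ C := by
  rintro X ⟨⟨Y, hY, e, he⟩, hXA⟩
  have := hP.nontrivial
  obtain ⟨κ, Z, hZ, r, hr⟩ := exists_isQuotientMap_of_generatedBy ⟨P, hPC, inferInstance⟩ hY
  -- There is one prime factor for every point of the sum. A set is open in `Z k` when it is a
  -- neighbourhood of each of its points, so together these factors still determine the topology of
  -- `Y`.
  let Q : (Σ k, Z k) → TopCat.{u} := fun i => primeFactor (Z i.1) i.2
  let p : ∀ i, Q i := fun i => i.2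
  let q : ∀ i, Q i → Y := fun i x => r ⟨i.1, x⟩
  have hQ : ∀ i, C (Q i) := fun i => hC.primeFactor_mem hA hA₂ hPC hP (hZ i.1) i.2
  have hiso : ∀ i x, x ≠ p i → IsOpen ({x} : Set (Q i)) :=
    fun i x hx => isOpen_primeFactor.2 fun h => (hx (Eq.symm h)).elim
  have hrk : ∀ k, Continuous fun z : Z k => r ⟨k, z⟩ := fun k =>
    hr.continuous.comp (continuous_sigmaMk (σ := fun k => (Z k : Type u)) (i := k))
  have hqc : ∀ i, Continuous (q i) := fun i =>
    ⟨fun W hW => isOpen_primeFactor.2 fun h => (hW.preimage (hrk i.1)).mem_nhds h⟩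
  have hqo : ∀ U : Set Y, (∀ i, IsOpen (q i ⁻¹' U)) → IsOpen U := by
    refine fun U hU => hr.isOpen_preimage.1 (isOpen_sigma_iff.2 fun k => ?_)
    exact isOpen_iff_mem_nhds.2 fun z hz => isOpen_primeFactor.1 (hU ⟨k, z⟩) hz
  have hT : C (pathSpace Q p Y q) :=
    hC.mem_of_generatedBy (hA.pathSpace_mem hA₂ fun i => hC.le _ (hQ i))
      (generatedBy_pathSpace hQ hiso)
  let S : Set (pathSpace Q p Y q) := pathEnd Q Y q ⁻¹' Set.range e
  have hS : C (TopCat.of S) := hC.hereditary _ ⟨_, hT, Subtype.val, IsEmbedding.subtypeVal⟩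
  choose f hf using fun t : S => t.2
  have hfc : Continuous f := by
    refine he.continuous_iff.2 ?_
    rw [show e ∘ f = fun t : S => pathEnd Q Y q t.1 from funext hf]
    exact (continuous_pathEnd hqc).comp continuous_subtype_val
  refine hC.mem_of_generatedBy hXA fun U hU => ?_
  obtain ⟨V, hV, hVU⟩ := isOpen_induced_iff.1 (hU _ hS f hfc)
  have hmem : ∀ t : S, t.1 ∈ V ↔ f t ∈ U := fun t => Set.ext_iff.1 hVU t
  -- `S` is the full preimage of `X`, so the image of `V` in `Y` traces exactly `U` on `X`.
  refine he.isOpen_iff.2 ⟨_, isOpenMap_pathEnd hiso hqo V hV, ?_⟩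
  ext x
  constructor
  · rintro ⟨t, htV, ht⟩
    have hfx : f ⟨t, x, ht.symm⟩ = x := he.injective ((hf _).trans ht)
    exact hfx ▸ (hmem ⟨t, x, ht.symm⟩).1 htV
  · intro hx
    -- The empty path at `e x` lies over `x`.
    let t : pathSpace Q p Y q := (show Y × List (Σ i, Q i) from (e x, []))
    have hfx : f ⟨t, x, rfl⟩ = x := he.injective (hf _)
    exact ⟨t, (hmem ⟨t, x, rfl⟩).2 (hfx.symm ▸ hx), rfl⟩

lemma isLeast_subspacesOf_generatedBy_inf {A B : ObjectProperty TopCat.{u}}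
    (hA : IsEpireflective A) (hA₂ : ¬ A twoPointIndiscrete) (hBA : B ≤ A)
    (hB : ∃ P : TopCat.{u}, B P ∧ IsPrimeSpace P) :
    IsLeast {C | IsHADClass A C ∧ B ≤ C} (subspacesOf (generatedBy B) ⊓ A) := by
  obtain ⟨P, hPB, hP⟩ := hB
  have := hP.nontrivial
  have hgen := generatedBy_subspacesOf_le (generatedBy_idem B)
    ⟨P, le_generatedBy B P hPB, inferInstance⟩
  have hle : B ≤ subspacesOf (generatedBy B) ⊓ A := fun X hX =>
    ⟨le_subspacesOf _ X (le_generatedBy B X hX), hBA X hX⟩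
  refine ⟨⟨?_, hle⟩, fun C hC => ?_⟩
  · exact
      { iso_closed := fun X Y h hX =>
          ⟨iso_closed_of_generatedBy_le hgen h hX.1, hA.iso_closed h hX.2⟩
        exists_nontrivial := ⟨P, hle P hPB, this⟩
        le := inf_le_right
        hereditary := fun X ⟨Y, hY, hXY⟩ =>
          ⟨isHereditary_subspacesOf _ X ⟨Y, hY.1, hXY⟩, hA.hereditary X ⟨Y, hY.2, hXY⟩⟩
        additive := fun X ⟨ι, Y, hY, e⟩ =>
          ⟨isAdditive_of_generatedBy_le hgen X ⟨ι, Y, fun i => (hY i).1, e⟩,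
            hA.additive hA₂ X ⟨ι, Y, fun i => (hY i).2, e⟩⟩
        divisible := fun Y ⟨⟨X, hX, q, hq⟩, hY⟩ =>
          ⟨hgen Y (generatedBy_of_isQuotientMap (le_generatedBy _ X hX.1) hq), hY⟩ }
  · exact le_trans (inf_le_inf_right A (subspacesOf_mono (generatedBy_mono hC.2)))
      (hC.1.subspacesOf_generatedBy_le hA hA₂ (hC.2 P hPB) hP)

theorem corollary4p9 (A B : ObjectProperty TopCat.{u}) (hA : IsEpireflective A)
    (hA₂ : ¬ A twoPointIndiscrete) (hBA : B ≤ A) (hB : ∃ P : TopCat.{u}, B P ∧ IsPrimeSpace P) :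
    -- the three hulls are the smallest classes of the respective kind
    IsLeast {C | IsHADClass A C ∧ B ≤ C} (HADHull A B) ∧
    IsLeast {C | IsCoreflective C ∧ B ≤ C} (CH B) ∧
    IsLeast {C | IsHereditaryCoreflective C ∧ B ≤ C} (SCH B) ∧
    HADHull A B = SCH B ⊓ A ∧
    SCH B ⊓ A = subspacesOf (CH B) ⊓ A ∧
    subspacesOf (CH B) ⊓ A = subspacesOf (quotientsOf (sumsOf B)) ⊓ A := by
  have hB' : ∃ X : TopCat.{u}, B X ∧ Nontrivial X := by
    obtain ⟨P, hPB, hP⟩ := hB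
    exact ⟨P, hPB, hP.nontrivial⟩
  have hHAD := isLeast_subspacesOf_generatedBy_inf hA hA₂ hBA hB
  have hCH := isLeast_generatedBy hB'
  have hSCH := isLeast_subspacesOf_generatedBy hB'
  have h₁ : HADHull A B = _ := hull_eq_of_isLeast hHAD
  have h₂ : CH B = _ := hull_eq_of_isLeast hCH
  have h₃ : SCH B = _ := hull_eq_of_isLeast hSCH
  have hne : ∃ X : TopCat.{u}, B X ∧ Nonempty X := by
    obtain ⟨X, hX, _⟩ := hB'
    exact ⟨X, hX, inferInstance⟩
  rw [h₁, h₂, h₃]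
  exact ⟨hHAD, hCH, hSCH, rfl, rfl, by rw [generatedBy_eq hne]⟩
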